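/- Let $d\ge 1$, let $\|\cdot\|$ and $\langle\cdot;\cdot\rangle$ be the Euclidean norm and inner product of $\mathbb{R}^d$, let $S^{d-1}$ be the Euclidean unit sphere and $D$ the closed unit ball. For a function $f:\mathbb{R}^d\to\mathbb{R}$ that is $r$ times continuously differentiable and $0\le \ell\le r$, put $M_\ell(f)=\sup_{x\in\mathbb{R}^d}\|\mathbf{D}^\ell(f)(x)\|_{op}$, where $\mathbf{D}^\ell(f)(x)$ is the $\ell$-th derivative viewed as an $\ell$-linear form, $\|F\|_{op}=\sup\{|F(v_1,\dots,v_\ell)|:\|v_j\|=1\}$, and $M_0(f)=\sup_x|f(x)|$. Let $\mathcal{H}_2$ be the set of bounded, twice continuously differentiable functions $f:\mathbb{R}^d\to\mathbb{R}$ with $\max_{0\le\ell\le 2}M_\ell(f)\le 1$. Let $X$ be a random vector in $\mathbb{R}^d$ with law $\mu_X$ and characteristic function $\varphi$ such that: - $X$ is non-degenerate: the support of $\mu_X$ is not contained in any $(d-1)$-dimensional subspace of $\mathbb{R}^d$; - $\mathbb{E}\|X\|<\infty$; - $X$ is self-decomposable: for every $\gamma\in(0,1)$ there is a probability measure $\mu_\gamma$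 on $\mathbb{R}^d$ whose characteristic function $\widehat{\mu_\gamma}$ satisfies $\varphi(\xi)=\varphi(\gamma\xi)\,\widehat{\mu_\gamma}(\xi)$ for all $\xi\in\mathbb{R}^d$; - $X$ is infinitely divisible without Gaussian component: for some $b\in\mathbb{R}^d$ and some Lévy measure $\nu$ (a positive Borel measure with $\nu(\{0\})=0$ and $\int(1\wedge\|u\|^2)\,\nu(du)<\infty$), $$\varphi(\xi)=\exp\Big(i\langle b;\xi\rangle+\int_{\mathbb{R}^d}\big(e^{i\langle\xi;u\rangle}-1-i\langle\xi;u\rangle\mathbf{1}_D(u)\big)\nu(du)\Big),\qquad \xi\in\mathbb{R}^d;$$ - in the polar decomposition of $\nu$, $$\nu(B)=\int_{S^{d-1}}\lambda(dx)\int_0^{+\infty}\mathbf{1}_B(rx)\,k_x(r)\,\frac{dr}{r}\qquad (B\subset\mathbb{R}^d\setminus\{0\}\ \text{Borel}),$$ where $\lambda$ is a probability measure on $S^{d-1}$, $k_x(r)\ge 0$ is measurable in $x$ and non-increasing and right-continuous in $r>0$, and $\int_0^\infty(r^2\wedge1)k_x(r)\frac{dr}{r}$ is finite and independent of $x$, the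 functions $k_x$ satisfy, for all $0<a<b<+\infty$, $$\sup_{x\in S^{d-1}}\ \sup_{r\in(a,b)}k_x(r)<+\infty,$$ the supremum over $x$ being the $\lambda$-essential supremum. For $t\ge 0$ let $\mu_t$ be the probability measure on $\mathbb{R}^d$ with characteristic function $\xi\mapsto\varphi(\xi)/\varphi(e^{-t}\xi)$, and for bounded continuous $f$ let $P^\nu_t(f)(x)=\int_{\mathbb{R}^d}f(u+e^{-t}x)\,\mu_t(du)$. Then, for every $h\in\mathcal{H}_2$, the function $$f_h(x)=-\int_0^{+\infty}\big(P^\nu_t(h)(x)-\mathbb{E}h(X)\big)\,dt,\qquad x\in\mathbb{R}^d,$$ is well defined (the integral converges absolutely for every $x$) and twice continuously differentiable on $\mathbb{R}^d$, and it satisfies $$M_1(f_h)\le\sqrt d,\qquad M_2(f_h)\le\frac d2 .$$ -/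

import Mathlib

open MeasureTheory Set
open scoped ENNReal RealInnerProductSpace

noncomputable section

namespace SteinSD

/-- `ℝᵈ` with its Euclidean norm and inner product. -/
abbrev Euc (d : ℕ) : Type := EuclideanSpace ℝ (Fin d)

/-- The Euclidean unit sphere of `ℝᵈ`. -/
abbrev UnitSphere (d : ℕ) : Type := Metric.sphere (0 : Euc d) 1

variable {d : ℕ}

/-- `M_ℓ(f)`: the supremum over `x` of the operator norm of the `ℓ`-th derivative of `f` at `x`,
as an extended nonnegative number. For `ℓ = 0` this is the supremum of `|f|`. -/
def M (l : ℕ) (f : Euc d → ℝ) : ℝ≥0∞ := ⨆ x, ‖iteratedFDeriv ℝ l f x‖ₑ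

/-- `H_r`: the `r` times continuously differentiable functions with `M_ℓ(f) ≤ 1` for
`0 ≤ ℓ ≤ r` (they are bounded, by the case `ℓ = 0`). -/
def H (d r : ℕ) : Set (Euc d → ℝ) :=
  {f | ContDiff ℝ r f ∧ ∀ l ≤ r, M l f ≤ 1}

/-- Non-degeneracy: the support is contained in no `(d - 1)`-dimensional subspace. -/
def IsNondegenerate (μ : Measure (Euc d)) : Prop :=
  ∀ V : Submodule ℝ (Euc d), Module.finrank ℝ V + 1 = d → ¬ μ.support ⊆ (V : Set (Euc d))

/-- `ν` is a Lévy measure. -/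
def IsLevyMeasure (ν : Measure (Euc d)) : Prop :=
  ν {0} = 0 ∧ ∫⁻ u, ENNReal.ofReal (min 1 (‖u‖ ^ 2)) ∂ν < ∞

/-- `μ` is infinitely divisible with triplet `(b, A, ν)`, by its Lévy-Khintchine representation
with truncation to the closed unit ball. -/
def IsInfDivWithTriplet (μ : Measure (Euc d)) (b : Euc d) (A : Matrix (Fin d) (Fin d) ℝ)
    (ν : Measure (Euc d)) : Prop :=
  A.PosSemidef ∧ IsLevyMeasure ν ∧
    ∀ ξ : Euc d, charFun μ ξ =
      Complex.exp (Complex.I * (⟪b, ξ⟫ : ℝ) - 1 / 2 * (⟪ξ, Matrix.toEuclideanLin A ξ⟫ : ℝ) +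
        ∫ u, (Complex.exp (Complex.I * (⟪ξ, u⟫ : ℝ)) - 1 -
          Complex.I * ((Metric.closedBall (0 : Euc d) 1).indicator (fun u => ⟪ξ, u⟫) u : ℝ)) ∂ν)

/-- `ρ` is a probability measure with `φ(ξ) = φ(γ ξ) ρ̂(ξ)`, where `φ` is the characteristic
function of `μ`. -/
def IsSDFactor (μ : Measure (Euc d)) (γ : ℝ) (ρ : Measure (Euc d)) : Prop :=
  IsProbabilityMeasure ρ ∧ ∀ ξ, charFun μ ξ = charFun μ (γ • ξ) * charFun ρ ξ

/-- Self-decomposability. -/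
def IsSelfDecomposable (μ : Measure (Euc d)) : Prop :=
  ∀ γ ∈ Ioo (0 : ℝ) 1, ∃ ρ, IsSDFactor μ γ ρ

/-- A polar decomposition `ν(B) = ∫_{S^{d-1}} λ(dx) ∫_0^∞ 1_B(r x) k_x(r) dr / r` of `ν`, with
`λ` and `k` normalized in the usual way. -/
structure IsPolarDecomposition (ν : Measure (Euc d)) (lam : Measure (UnitSphere d))
    (k : UnitSphere d → ℝ → ℝ) : Prop where
  prob : IsProbabilityMeasure lam
  nonneg : ∀ x, ∀ r ∈ Ioi (0 : ℝ), 0 ≤ k x r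
  measurable : ∀ r ∈ Ioi (0 : ℝ), AEMeasurable (fun x => k x r) lam
  antitone : ∀ x, AntitoneOn (k x) (Ioi 0)
  rightContinuous : ∀ x, ∀ r ∈ Ioi (0 : ℝ), ContinuousWithinAt (k x) (Ici r) r
  normalized : ∃ c < ∞, ∀ x,
    (∫⁻ r : ℝ in Ioi 0, ENNReal.ofReal (min (r ^ 2) 1 * (k x r / r))) = c
  polar : ∀ B : Set (Euc d), MeasurableSet B → (0 : Euc d) ∉ B →
    ν B = ∫⁻ x : UnitSphere d, (∫⁻ r : ℝ in Ioi 0,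
      B.indicator 1 (r • (x : Euc d)) * ENNReal.ofReal (k x r / r)) ∂lam

/-- For all `0 < a < b < ∞`, the (`λ`-essential) supremum over `x` of `sup_{r ∈ (a, b)} k_x(r)` is
finite. -/
def LocallyBoundedRadial (lam : Measure (UnitSphere d)) (k : UnitSphere d → ℝ → ℝ) : Prop :=
  ∀ a b : ℝ, 0 < a → a < b → ∃ C : ℝ, ∀ᵐ x ∂lam, ∀ r ∈ Ioo a b, k x r ≤ C

/-- `μ_t`: the probability measure with characteristic function `φ(ξ) / φ(e^{-t} ξ)`. It exists for
self-decomposable `μ` and `t ≥ 0`, and is unique when `φ` has no zeros (as for every infinitely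
divisible law), see `isSDFactor_muT` and `IsSDFactor.unique` below. -/
def muT (μ : Measure (Euc d)) (t : ℝ) : Measure (Euc d) :=
  Classical.epsilon (IsSDFactor μ (Real.exp (-t)))

/-- The operator `P_t` on bounded continuous functions, `P_t f(x) = ∫ f(u + e^{-t} x) μ_t(du)`.
It extends the Fourier multiplier operator on Schwartz functions, see `P_schwartz` below. -/
def P (μ : Measure (Euc d)) (t : ℝ) (f : Euc d → ℝ) (x : Euc d) : ℝ :=
  ∫ u, f (u + Real.exp (-t) • x) ∂(muT μ t)

/-- The Stein solution `f_h(x) = -∫_0^∞ (P_t h(x) - E h(X)) dt`, where `X` has law `μ`. -/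
def steinSolution (μ : Measure (Euc d)) (h : Euc d → ℝ) (x : Euc d) : ℝ :=
  -∫ t in Ioi (0 : ℝ), (P μ t h x - ∫ y, h y ∂μ)

/-- The Fourier transform with the normalization `∫ f(x) e^{-i⟨ξ, x⟩} dx`. -/
def fourierT (f : Euc d → ℝ) (ξ : Euc d) : ℂ :=
  ∫ x, (f x : ℂ) * Complex.exp (-(Complex.I * (⟪ξ, x⟫ : ℝ)))

theorem isSDFactor_muT {μ : Measure (Euc d)} (hμ : IsSelfDecomposable μ) {t : ℝ} (ht : 0 ≤ t) :
    IsSDFactor μ (Real.exp (-t)) (muT μ t) := by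
  refine Classical.epsilon_spec (p := IsSDFactor μ (Real.exp (-t))) ?_
  rcases ht.eq_or_lt with rfl | ht
  · refine ⟨Measure.dirac 0, inferInstance, fun ξ => ?_⟩
    simp [charFun_dirac]
  · exact hμ _ ⟨Real.exp_pos _, Real.exp_lt_one_iff.2 (by linarith)⟩

theorem IsSDFactor.unique {μ ρ ρ' : Measure (Euc d)} {γ : ℝ} (h0 : ∀ ξ, charFun μ ξ ≠ 0)
    (h : IsSDFactor μ γ ρ) (h' : IsSDFactor μ γ ρ') : ρ = ρ' := by
  have := h.1
  have := h'.1
  exact Measure.ext_of_charFun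
    (funext fun ξ => mul_left_cancel₀ (h0 (γ • ξ)) ((h.2 ξ).symm.trans (h'.2 ξ)))

theorem fourierT_inversion (f : SchwartzMap (Euc d) ℝ) :
    Integrable (fourierT f) ∧ ∀ y, (f y : ℂ) =
      (1 / (2 * Real.pi) ^ d : ℝ) * ∫ ξ, fourierT f ξ * Complex.exp (Complex.I * (⟪ξ, y⟫ : ℝ)) := by
  have hpi : (0 : ℝ) < 2 * Real.pi := by positivity
  set g : SchwartzMap (Euc d) ℂ := f.postcompCLM Complex.ofRealCLM with hg
  have hgf : ∀ x, g x = (f x : ℂ) := fun x => by simp [hg]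
  have key : ∀ w, FourierTransform.fourier (g : Euc d → ℂ) w =
      fourierT f ((2 * Real.pi) • w) := by
    intro w
    rw [Real.fourier_eq', fourierT]
    refine integral_congr_ae (Filter.Eventually.of_forall fun v => ?_)
    simp only [hgf, smul_eq_mul, real_inner_smul_left]
    rw [mul_comm, real_inner_comm]
    congr 2
    push_cast
    ring
  have hI : Integrable (FourierTransform.fourier (g : Euc d → ℂ)) := by
    rw [← SchwartzMap.fourier_coe]
    exact (FourierTransform.fourier g).integrable
  refine ⟨?_, fun y => ?_⟩
  · have h2 : Integrable (fun w => fourierT f ((2 * Real.pi) • w)) :=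
      hI.congr (Filter.Eventually.of_forall key)
    exact (integrable_comp_smul_iff volume (fourierT f) hpi.ne').1 h2
  · have h1 := congrFun (g.continuous.fourierInv_fourier_eq g.integrable hI) y
    rw [hgf, Real.fourierInv_eq'] at h1
    rw [← h1]
    have h3 := Measure.integral_comp_smul_of_nonneg volume
      (fun ξ => fourierT f ξ * Complex.exp (Complex.I * (⟪ξ, y⟫ : ℝ))) (2 * Real.pi) (hR := hpi.le)
    rw [finrank_euclideanSpace_fin] at h3
    rw [one_div, ← smul_eq_mul (a := (((((2 * Real.pi) ^ d)⁻¹ : ℝ)) : ℂ)), Complex.coe_smul, ← h3]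
    refine integral_congr_ae (Filter.Eventually.of_forall fun w => ?_)
    simp only [key, smul_eq_mul, real_inner_smul_left]
    rw [mul_comm]
    congr 2
    push_cast
    ring

/-- On Schwartz functions, `P_t` is given by the Fourier multiplier formula
`P_t f(x) = (2π)^{-d} ∫ F(f)(ξ) e^{i e^{-t} ⟨x, ξ⟩} φ(ξ) / φ(e^{-t} ξ) dξ`. -/
theorem P_schwartz {μ : Measure (Euc d)} (hμ : IsSelfDecomposable μ) (h0 : ∀ ξ, charFun μ ξ ≠ 0)
    {t : ℝ} (ht : 0 ≤ t) (f : SchwartzMap (Euc d) ℝ) (x : Euc d) :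
    (P μ t f x : ℂ) = (1 / (2 * Real.pi) ^ d : ℝ) *
      ∫ ξ, fourierT f ξ * Complex.exp (Complex.I * (Real.exp (-t) * ⟪x, ξ⟫ : ℝ)) *
        (charFun μ ξ / charFun μ (Real.exp (-t) • ξ)) := by
  obtain ⟨hI, hinv⟩ := fourierT_inversion f
  have hs := isSDFactor_muT hμ ht
  have := hs.1
  rw [P, ← integral_complex_ofReal]
  simp only [hinv]
  rw [integral_const_mul]
  congr 1
  rw [integral_integral_swap]
  · refine integral_congr_ae (Filter.Eventually.of_forall fun ξ => ?_)
    simp only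
    rw [integral_const_mul, mul_assoc]
    congr 1
    have hq : charFun μ ξ / charFun μ (Real.exp (-t) • ξ) = charFun (muT μ t) ξ := by
      rw [hs.2 ξ, mul_div_cancel_left₀ _ (h0 _)]
    rw [hq, charFun_apply, ← integral_const_mul]
    refine integral_congr_ae (Filter.Eventually.of_forall fun u => ?_)
    simp only
    rw [← Complex.exp_add]
    congr 1
    rw [inner_add_right, real_inner_smul_right, real_inner_comm u ξ, real_inner_comm x ξ]
    push_cast
    ring
  · have h1 : Integrable (fun z : Euc d × Euc d => fourierT f z.2) ((muT μ t).prod volume) :=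
      hI.comp_snd (muT μ t)
    refine (h1.mul_bdd (c := 1)
      (g := fun z : Euc d × Euc d =>
        Complex.exp (Complex.I * (⟪z.2, z.1 + Real.exp (-t) • x⟫ : ℝ))) ?_ ?_)
    · exact Continuous.aestronglyMeasurable (by fun_prop)
    · refine Filter.Eventually.of_forall fun z => ?_
      rw [mul_comm, Complex.norm_exp_ofReal_mul_I]

end SteinSD

end

open MeasureTheory ProbabilityTheory Filter Topology Set
open scoped ENNReal RealInnerProductSpace

namespace SteinSD

/-! ### Averages over a Markov kernel and their derivatives -/

section Kernel

variable {E : Type*} [NormedAddCommGroup E] [NormedSpace ℝ E] [MeasurableSpace E]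
  {F : Type*} [NormedAddCommGroup F] [NormedSpace ℝ F]

/-! Differentiating `P_t h(x) = ∫ h(u + e^{-t} x) μ_t(du)` under the integral gives `D^l P_t h =
e^{-lt} P_t (D^l h)`. Averaging against a probability measure does not increase the sup of the
operator norm, so `‖D^l P_t h‖ ≤ e^{-lt}`, and integrating over `t > 0` yields the bounds `1` and
`1/2`. They involve no dimension and imply the claim since `d ≥ 1`.

Convergence of the time integral comes from invariance of the law `μ` under `P_t`: `P_t h(x) - ∫ h
dμ` is the `μ`-mean over `y` of `P_t h(x) - P_t h(y)`, hence at most `e^{-t} ∫ ‖x - y‖ μ(dy)`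
(`norm_P_sub_integral_le`). Measurability in `t` holds because `t ↦ μ_t` is weakly continuous, its
characteristic function being a quotient with nonvanishing denominator (`continuous_muT_max`). -/

/-- The vector-valued operator `G ↦ (x ↦ ∫ G(u + e^{-t} x) κ_t(du))` of a kernel `κ`. -/
noncomputable def kernelAverage (κ : Kernel ℝ E) (t : ℝ) (G : E → F) (x : E) : F :=
  ∫ u, G (u + Real.exp (-t) • x) ∂(κ t)

variable {κ : Kernel ℝ E} [IsMarkovKernel κ] {G : E → F} {C : ℝ}

theorem norm_kernelAverage_le (hC : ∀ x, ‖G x‖ ≤ C) (t : ℝ) (x : E) :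
    ‖kernelAverage κ t G x‖ ≤ C := by
  refine (norm_integral_le_of_norm_le_const (C := C) (.of_forall fun u => hC _)).trans ?_
  simp

theorem norm_integral_smul_kernelAverage_le {a : ℝ → ℝ} (ha : IntegrableOn a (Ioi 0))
    (ha0 : ∀ t, 0 ≤ a t) (hC : ∀ x, ‖G x‖ ≤ C) (x : E) :
    ‖∫ t in Ioi (0 : ℝ), a t • kernelAverage κ t G x‖ ≤ (∫ t in Ioi (0 : ℝ), a t) * C := by
  rw [← integral_mul_const]
  refine norm_integral_le_of_norm_le (ha.mul_const C) (.of_forall fun t => ?_)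
  rw [norm_smul, Real.norm_of_nonneg (ha0 t)]
  exact mul_le_mul_of_nonneg_left (norm_kernelAverage_le hC t x) (ha0 t)

variable [BorelSpace E] [SecondCountableTopology E]

/-- Joint measurability in `t` and `u` needs `κ` to be a kernel, not just a family of measures. -/
theorem stronglyMeasurable_kernelAverage (hG : Continuous G) (x : E) :
    StronglyMeasurable fun t => kernelAverage κ t G x := by
  have h : Continuous (Function.uncurry fun (t : ℝ) (u : E) => G (u + Real.exp (-t) • x)) := by
    unfold Function.uncurry
    fun_prop
  exact StronglyMeasurable.integral_kernel_prod_right h.stronglyMeasurable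

theorem continuous_kernelAverage (hG : Continuous G) (hC : ∀ x, ‖G x‖ ≤ C) (t : ℝ) :
    Continuous (kernelAverage κ t G) := by
  refine continuous_of_dominated (bound := fun _ => C) (fun x => ?_)
    (fun x => .of_forall fun u => hC _) (integrable_const C) (.of_forall fun u => ?_)
  · exact Continuous.aestronglyMeasurable (by fun_prop)
  · fun_prop

theorem hasFDerivAt_kernelAverage {B : ℝ} (hG : ContDiff ℝ 1 G) (hB : ∀ x, ‖G x‖ ≤ B)
    (hC : ∀ x, ‖fderiv ℝ G x‖ ≤ C) (t : ℝ) (x : E) :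
    HasFDerivAt (kernelAverage κ t G)
      (Real.exp (-t) • kernelAverage κ t (fderiv ℝ G) x) x := by
  have hc : Continuous (fderiv ℝ G) := hG.continuous_fderiv one_ne_zero
  have key := hasFDerivAt_integral_of_dominated_of_fderiv_le (𝕜 := ℝ) (μ := κ t) (x₀ := x)
    (F := fun y u => G (u + Real.exp (-t) • y))
    (F' := fun y u => Real.exp (-t) • fderiv ℝ G (u + Real.exp (-t) • y))
    (bound := fun _ => Real.exp (-t) * C) (s := univ) univ_mem
    (.of_forall fun y => Continuous.aestronglyMeasurable (by have := hG.continuous; fun_prop))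
    (Integrable.of_bound (Continuous.aestronglyMeasurable (by have := hG.continuous; fun_prop)) B
      (.of_forall fun u => hB _))
    (Continuous.aestronglyMeasurable (by fun_prop))
    (.of_forall fun u y _ => ?_) (integrable_const _) (.of_forall fun u y _ => ?_)
  · rw [integral_smul] at key
    exact key
  · rw [norm_smul, Real.norm_of_nonneg (Real.exp_pos _).le]
    exact mul_le_mul_of_nonneg_left (hC _) (Real.exp_pos _).le
  · have h1 : HasFDerivAt (fun y : E => u + Real.exp (-t) • y)
        (Real.exp (-t) • ContinuousLinearMap.id ℝ E) y :=
      ((hasFDerivAt_id y).const_smul _).const_add u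
    have h2 := ((hG.differentiable one_ne_zero) (u + Real.exp (-t) • y)).hasFDerivAt.comp y h1
    refine h2.congr_fderiv ?_
    ext v
    simp

theorem integrableOn_smul_kernelAverage {a : ℝ → ℝ} (ha : IntegrableOn a (Ioi 0))
    (hG : Continuous G) (hC : ∀ x, ‖G x‖ ≤ C) (x : E) :
    IntegrableOn (fun t => a t • kernelAverage κ t G x) (Ioi 0) :=
  ha.smul_bdd C (stronglyMeasurable_kernelAverage hG x).aestronglyMeasurable
    (.of_forall fun t => norm_kernelAverage_le hC t x)

theorem continuous_neg_integral_smul_kernelAverage {a : ℝ → ℝ} (ha : IntegrableOn a (Ioi 0))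
    (hG : Continuous G) (hC : ∀ x, ‖G x‖ ≤ C) :
    Continuous fun x => -∫ t in Ioi (0 : ℝ), a t • kernelAverage κ t G x := by
  refine Continuous.neg <| continuous_of_dominated (bound := fun t => ‖a t‖ * C)
    (fun x => (integrableOn_smul_kernelAverage ha hG hC x).aestronglyMeasurable)
    (fun x => .of_forall fun t => ?_) (ha.norm.mul_const C) (.of_forall fun t => ?_)
  · rw [norm_smul]
    exact mul_le_mul_of_nonneg_left (norm_kernelAverage_le hC t x) (norm_nonneg _)
  · exact (continuous_kernelAverage hG hC t).const_smul _

/-- Used twice: with `a = 1`, `c = ∫ h dμ`, where only the centred integrand is integrable, and with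
`a t = e^{-t}`, `c = 0`. The chain rule supplies the factor `e^{-t}` that makes the differentiated
integrand integrable. -/
theorem hasFDerivAt_integral_smul_kernelAverage_sub {B : ℝ} {a : ℝ → ℝ} {c : F}
    (hG : ContDiff ℝ 1 G) (hB : ∀ x, ‖G x‖ ≤ B) (hC : ∀ x, ‖fderiv ℝ G x‖ ≤ C)
    (hint : ∀ x, IntegrableOn (fun t => a t • kernelAverage κ t G x - c) (Ioi 0))
    (ha : IntegrableOn (fun t => a t * Real.exp (-t)) (Ioi 0)) (x : E) :
    HasFDerivAt (fun x => ∫ t in Ioi (0 : ℝ), (a t • kernelAverage κ t G x - c))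
      (∫ t in Ioi (0 : ℝ), (a t * Real.exp (-t)) • kernelAverage κ t (fderiv ℝ G) x) x := by
  have hc : Continuous (fderiv ℝ G) := hG.continuous_fderiv one_ne_zero
  refine hasFDerivAt_integral_of_dominated_of_fderiv_le (𝕜 := ℝ)
    (F' := fun y t => (a t * Real.exp (-t)) • kernelAverage κ t (fderiv ℝ G) y)
    (bound := fun t => ‖a t * Real.exp (-t)‖ * C) (s := univ) univ_mem
    (.of_forall fun y => (hint y).aestronglyMeasurable) (hint x)
    (integrableOn_smul_kernelAverage ha hc hC x).aestronglyMeasurable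
    (.of_forall fun t y _ => ?_) (ha.norm.mul_const C) (.of_forall fun t y _ => ?_)
  · rw [norm_smul]
    exact mul_le_mul_of_nonneg_left (norm_kernelAverage_le hC t y) (norm_nonneg _)
  · rw [mul_smul]
    exact ((hasFDerivAt_kernelAverage hG hB hC t y).const_smul (a t)).sub_const c

end Kernel

/-! ### The measures `μ_t` as a kernel -/

/-- A weakly continuous family of probability measures is measurable. -/
theorem measurable_of_continuous_probabilityMeasure {T Ω : Type*} [TopologicalSpace T]
    [MeasurableSpace T] [BorelSpace T] [TopologicalSpace Ω] [MeasurableSpace Ω] [BorelSpace Ω]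
    [HasOuterApproxClosed Ω] {m : T → ProbabilityMeasure Ω} (hm : Continuous m) :
    Measurable fun t => (m t : Measure Ω) := by
  refine Measurable.measure_of_isPiSystem_of_isProbabilityMeasure
    (BorelSpace.measurable_eq (α := Ω)) isPiSystem_isOpen fun U hU => ?_
  -- Portmanteau: the mass of an open set is lower semicontinuous under weak convergence.
  refine LowerSemicontinuous.measurable (lowerSemicontinuous_iff_le_liminf.2 fun t => ?_)
  exact ProbabilityMeasure.le_liminf_measure_open_of_tendsto (hm.tendsto t) hU

variable {d : ℕ} {μ : Measure (Euc d)}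

/-- Lévy's continuity theorem reduces this to continuity in `t` of `φ(ξ) / φ(e^{-t} ξ)`. Time is
clamped at `0` because the defining property of `muT` is only guaranteed for `t ≥ 0`. -/
theorem continuous_muT_max [IsProbabilityMeasure μ] (hμ : IsSelfDecomposable μ)
    (h0 : ∀ ξ, charFun μ ξ ≠ 0) :
    Continuous (Y := ProbabilityMeasure (Euc d)) fun t : ℝ =>
      ⟨muT μ (max t 0), (isSDFactor_muT hμ (le_max_right t 0)).1⟩ := by
  refine SeqContinuous.continuous fun s t hst => ?_
  refine ProbabilityMeasure.tendsto_iff_tendsto_charFun.2 fun ξ => ?_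
  have hq : ∀ t : ℝ, charFun (muT μ (max t 0)) ξ
      = charFun μ ξ / charFun μ (Real.exp (-(max t 0)) • ξ) := fun t => by
    rw [(isSDFactor_muT hμ (le_max_right t 0)).2 ξ, mul_div_cancel_left₀ _ (h0 _)]
  have hc : Continuous fun t : ℝ => charFun (muT μ (max t 0)) ξ := by
    simp_rw [hq]
    exact continuous_const.div₀ (continuous_charFun.comp (by fun_prop)) fun t => h0 _
  exact (hc.tendsto t).comp hst

/-- The family `μ_t` as a Markov kernel, extended by `μ_0` to negative times. -/
noncomputable def muKernel [IsProbabilityMeasure μ] (hμ : IsSelfDecomposable μ)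
    (h0 : ∀ ξ, charFun μ ξ ≠ 0) : Kernel ℝ (Euc d) :=
  ⟨fun t => muT μ (max t 0),
    measurable_of_continuous_probabilityMeasure (continuous_muT_max hμ h0)⟩

instance [IsProbabilityMeasure μ] (hμ : IsSelfDecomposable μ) (h0 : ∀ ξ, charFun μ ξ ≠ 0) :
    IsMarkovKernel (muKernel hμ h0) :=
  ⟨fun t => (isSDFactor_muT hμ (le_max_right t 0)).1⟩

theorem P_eq_kernelAverage [IsProbabilityMeasure μ] (hμ : IsSelfDecomposable μ)
    (h0 : ∀ ξ, charFun μ ξ ≠ 0) {t : ℝ} (ht : 0 ≤ t) (f : Euc d → ℝ) (x : Euc d) :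
    P μ t f x = kernelAverage (muKernel hμ h0) t f x := by
  change _ = ∫ u, f (u + Real.exp (-t) • x) ∂(muT μ (max t 0))
  rw [max_eq_left ht, P]

/-! ### Invariance and exponential convergence -/

/-- Self-decomposability in law: `X` is distributed as `e^{-t} X + Y_t` with `Y_t ∼ μ_t` independent
of `X`. -/
theorem muT_conv_map_smul [IsProbabilityMeasure μ] (hμ : IsSelfDecomposable μ) {t : ℝ}
    (ht : 0 ≤ t) : muT μ t ∗ μ.map (Real.exp (-t) • ·) = μ := by
  have hs := isSDFactor_muT hμ ht
  have := hs.1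
  have : IsProbabilityMeasure (μ.map (Real.exp (-t) • ·)) :=
    Measure.isProbabilityMeasure_map (by fun_prop)
  refine Measure.ext_of_charFun (funext fun ξ => ?_)
  rw [charFun_conv, charFun_map_smul, hs.2 ξ, mul_comm]

/-- `μ` is invariant under `P_t`. -/
theorem integral_P [IsProbabilityMeasure μ] (hμ : IsSelfDecomposable μ) {t : ℝ} (ht : 0 ≤ t)
    {f : Euc d → ℝ} (hf : Continuous f) {C : ℝ} (hC : ∀ x, ‖f x‖ ≤ C) :
    ∫ y, P μ t f y ∂μ = ∫ y, f y ∂μ := by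
  have := (isSDFactor_muT hμ ht).1
  have : IsProbabilityMeasure (μ.map (Real.exp (-t) • ·)) :=
    Measure.isProbabilityMeasure_map (by fun_prop)
  conv_rhs => rw [← muT_conv_map_smul hμ ht]
  rw [integral_conv (Integrable.of_bound hf.aestronglyMeasurable C (.of_forall hC))]
  have hm : ∀ u, ∫ y, f (u + y) ∂(μ.map (Real.exp (-t) • ·))
      = ∫ y, f (u + Real.exp (-t) • y) ∂μ := fun u =>
    integral_map (by fun_prop) (Continuous.aestronglyMeasurable (by fun_prop))
  simp_rw [hm, P]
  refine integral_integral_swap (Integrable.of_bound ?_ C (.of_forall fun z => hC _))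
  exact Continuous.aestronglyMeasurable (by unfold Function.uncurry; fun_prop)

theorem norm_P_sub_integral_le [IsProbabilityMeasure μ] (hμ : IsSelfDecomposable μ)
    (hint : Integrable (fun y => y) μ) {t : ℝ} (ht : 0 ≤ t)
    {f : Euc d → ℝ} {K : NNReal} (hf : LipschitzWith K f) {C : ℝ} (hC : ∀ x, ‖f x‖ ≤ C)
    (x : Euc d) :
    ‖P μ t f x - ∫ y, f y ∂μ‖ ≤ Real.exp (-t) * (K * ∫ y, ‖x - y‖ ∂μ) := by
  have := (isSDFactor_muT hμ ht).1
  have hi : ∀ y, Integrable (fun u => f (u + Real.exp (-t) • y)) (muT μ t) := fun y =>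
    Integrable.of_bound (Continuous.aestronglyMeasurable (by have := hf.continuous; fun_prop)) C
      (.of_forall fun u => hC _)
  have hP : ∀ y, ‖P μ t f x - P μ t f y‖ ≤ Real.exp (-t) * (K * ‖x - y‖) := fun y => by
    rw [P, P, ← integral_sub (hi x) (hi y)]
    refine (norm_integral_le_of_norm_le_const (C := Real.exp (-t) * (K * ‖x - y‖))
      (.of_forall fun u => ?_)).trans (by simp)
    refine (hf.norm_sub_le _ _).trans_eq ?_
    rw [add_sub_add_left_eq_sub, ← smul_sub, norm_smul, Real.norm_of_nonneg (Real.exp_pos _).le]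
    ring
  have hPb : Integrable (fun y => P μ t f y) μ := by
    refine Integrable.of_bound (C := C) ?_ (.of_forall fun y => ?_)
    · refine Continuous.aestronglyMeasurable (continuous_of_dominated (bound := fun _ => C)
        (fun y => (hi y).aestronglyMeasurable) (fun y => .of_forall fun u => hC _)
        (integrable_const C) (.of_forall fun u => ?_))
      have := hf.continuous
      fun_prop
    · exact (norm_integral_le_of_norm_le_const (C := C) (.of_forall fun u => hC _)).trans (by simp)
  have hs : P μ t f x - ∫ y, f y ∂μ = ∫ y, (P μ t f x - P μ t f y) ∂μ := by
    rw [integral_sub (integrable_const _) hPb, integral_P hμ ht hf.continuous hC]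
    simp
  rw [hs, ← integral_const_mul, ← integral_const_mul]
  exact norm_integral_le_of_norm_le
    ((((integrable_const x).sub hint).norm.const_mul _).const_mul _) (.of_forall hP)

/-! ### Regularity of the Stein solution -/

theorem integrableOn_exp_neg_mul_self :
    IntegrableOn (fun t : ℝ => Real.exp (-t) * Real.exp (-t)) (Ioi 0) := by
  simp_rw [← Real.exp_add, ← two_mul, mul_neg, ← neg_mul]
  exact integrableOn_exp_mul_Ioi (by norm_num) 0

theorem integral_exp_neg_mul_self :
    ∫ t : ℝ in Ioi 0, Real.exp (-t) * Real.exp (-t) = 1 / 2 := by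
  simp_rw [← Real.exp_add, ← two_mul, mul_neg, ← neg_mul]
  rw [integral_exp_mul_Ioi (by norm_num) 0]
  norm_num

theorem norm_iteratedFDeriv_le_one_of_mem_H {r : ℕ} {h : Euc d → ℝ} (hh : h ∈ H d r) {l : ℕ}
    (hl : l ≤ r) (x : Euc d) : ‖iteratedFDeriv ℝ l h x‖ ≤ 1 := by
  have h1 := (le_iSup (fun x => ‖iteratedFDeriv ℝ l h x‖ₑ) x).trans (hh.2 l hl)
  rw [← ofReal_norm] at h1
  exact ENNReal.ofReal_le_one.1 h1

theorem M_le_ofReal {l : ℕ} {f : Euc d → ℝ} {C : ℝ} (hf : ∀ x, ‖iteratedFDeriv ℝ l f x‖ ≤ C) :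
    M l f ≤ ENNReal.ofReal C :=
  iSup_le fun x => by
    rw [← ofReal_norm]
    exact ENNReal.ofReal_le_ofReal (hf x)

/-- Smoothness and dimension-free bounds for the Stein solution of a self-decomposable law with a
finite first moment and nowhere vanishing characteristic function. -/
theorem steinSolution_smooth [IsProbabilityMeasure μ] (hμ : IsSelfDecomposable μ)
    (h0 : ∀ ξ, charFun μ ξ ≠ 0) (hint : Integrable (fun y => y) μ)
    {h : Euc d → ℝ} (hh : h ∈ H d 2) :
    (∀ x, IntegrableOn (fun t => P μ t h x - ∫ y, h y ∂μ) (Ioi 0)) ∧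
    ContDiff ℝ 2 (steinSolution μ h) ∧
    M 1 (steinSolution μ h) ≤ ENNReal.ofReal 1 ∧
    M 2 (steinSolution μ h) ≤ ENNReal.ofReal (1 / 2) := by
  set κ := muKernel hμ h0
  have hh2 : ContDiff ℝ 2 h := hh.1
  have hh1 : ContDiff ℝ 1 h := hh2.of_le (by norm_num)
  have hD1 : ContDiff ℝ 1 (fderiv ℝ h) := hh2.fderiv_right (by norm_num)
  have hD2 : Continuous (fderiv ℝ (fderiv ℝ h)) := hD1.continuous_fderiv one_ne_zero
  have b0 : ∀ x, ‖h x‖ ≤ 1 := fun x => by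
    simpa using norm_iteratedFDeriv_le_one_of_mem_H hh (Nat.zero_le 2) x
  have b1 : ∀ x, ‖fderiv ℝ h x‖ ≤ 1 := fun x => by
    simpa using norm_iteratedFDeriv_le_one_of_mem_H hh one_le_two x
  have b2 : ∀ x, ‖fderiv ℝ (fderiv ℝ h) x‖ ≤ 1 := fun x => by
    rw [← norm_iteratedFDeriv_one, norm_iteratedFDeriv_fderiv]
    exact norm_iteratedFDeriv_le_one_of_mem_H hh le_rfl x
  have hLip : LipschitzWith 1 h :=
    lipschitzWith_of_nnnorm_fderiv_le (hh1.differentiable one_ne_zero) b1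
  have hexp : IntegrableOn (fun t : ℝ => Real.exp (-t)) (Ioi 0) := integrableOn_exp_neg_Ioi 0
  have hmeas : ∀ x, AEStronglyMeasurable (fun t => P μ t h x) (volume.restrict (Ioi 0)) :=
    fun x => (stronglyMeasurable_kernelAverage (κ := κ) hh1.continuous x).aestronglyMeasurable.congr
      ((ae_restrict_mem measurableSet_Ioi).mono fun t ht =>
        (P_eq_kernelAverage hμ h0 (le_of_lt ht) h x).symm)
  have hI : ∀ x, IntegrableOn (fun t => P μ t h x - ∫ y, h y ∂μ) (Ioi 0) := fun x =>
    Integrable.mono' (hexp.mul_const _) ((hmeas x).sub aestronglyMeasurable_const)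
      ((ae_restrict_mem measurableSet_Ioi).mono fun t ht =>
        norm_P_sub_integral_le hμ hint (le_of_lt ht) hLip b0 x)
  have hI' : ∀ x, IntegrableOn
      (fun t => (1 : ℝ) • kernelAverage κ t h x - ∫ y, h y ∂μ) (Ioi 0) := fun x =>
    (hI x).congr_fun (fun t ht => by
      simp only [P_eq_kernelAverage hμ h0 (le_of_lt ht) h x, one_smul, κ]) measurableSet_Ioi
  have hS : steinSolution μ h = fun x => -∫ t in Ioi (0 : ℝ),
      ((1 : ℝ) • kernelAverage κ t h x - ∫ y, h y ∂μ) := by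
    funext x
    refine congrArg Neg.neg (setIntegral_congr_fun measurableSet_Ioi fun t ht => ?_)
    simp only [P_eq_kernelAverage hμ h0 (le_of_lt ht) h x, one_smul, κ]
  set S1 : Euc d → Euc d →L[ℝ] ℝ := fun x =>
    -∫ t in Ioi (0 : ℝ), Real.exp (-t) • kernelAverage κ t (fderiv ℝ h) x with hS1
  -- One factor `e^{-t}` for each differentiation.
  set S2 : Euc d → Euc d →L[ℝ] Euc d →L[ℝ] ℝ := fun x => -∫ t in Ioi (0 : ℝ),
    (Real.exp (-t) * Real.exp (-t)) • kernelAverage κ t (fderiv ℝ (fderiv ℝ h)) x with hS2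
  have d1 : ∀ x, HasFDerivAt (steinSolution μ h) (S1 x) x := fun x => by
    rw [hS]
    have := (hasFDerivAt_integral_smul_kernelAverage_sub (a := fun _ => 1) hh1 b0 b1 hI'
      (by simpa using hexp) x).fun_neg
    simpa only [one_mul] using this
  have d2 : ∀ x, HasFDerivAt S1 (S2 x) x := fun x => by
    have := (hasFDerivAt_integral_smul_kernelAverage_sub (κ := κ) (c := 0) hD1 b1 b2
      (by simpa only [sub_zero] using
        integrableOn_smul_kernelAverage hexp hD1.continuous b1)
      integrableOn_exp_neg_mul_self x).fun_neg
    simpa only [sub_zero] using this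
  have c2 : Continuous S2 :=
    continuous_neg_integral_smul_kernelAverage (κ := κ) integrableOn_exp_neg_mul_self hD2 b2
  have e1 : fderiv ℝ (steinSolution μ h) = S1 := funext fun x => (d1 x).fderiv
  have e2 : fderiv ℝ S1 = S2 := funext fun x => (d2 x).fderiv
  refine ⟨hI, ?_, M_le_ofReal fun x => ?_, M_le_ofReal fun x => ?_⟩
  · exact contDiff_succ_iff_hasFDerivAt (n := 1).2
      ⟨S1, contDiff_one_iff_hasFDerivAt.2 ⟨S2, c2, d2⟩, d1⟩
  · rw [norm_iteratedFDeriv_one, e1, hS1, norm_neg]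
    refine (norm_integral_smul_kernelAverage_le hexp (fun t => (Real.exp_pos _).le) b1 x).trans_eq ?_
    rw [integral_exp_neg_Ioi_zero, mul_one]
  · rw [← norm_iteratedFDeriv_fderiv, norm_iteratedFDeriv_one, e1, e2, hS2, norm_neg]
    refine (norm_integral_smul_kernelAverage_le integrableOn_exp_neg_mul_self
      (fun t => by positivity) b2 x).trans_eq ?_
    rw [integral_exp_neg_mul_self, mul_one]

end SteinSD

theorem mainTheorem10 {d : ℕ} (hd : 1 ≤ d)
    {Ω : Type*} [MeasurableSpace Ω] (Pr : MeasureTheory.Measure Ω)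
    [MeasureTheory.IsProbabilityMeasure Pr]
    (X : Ω → SteinSD.Euc d) (hX : AEMeasurable X Pr)
    (hnd : SteinSD.IsNondegenerate (Pr.map X))
    (hsd : SteinSD.IsSelfDecomposable (Pr.map X))
    (b : SteinSD.Euc d) (ν : MeasureTheory.Measure (SteinSD.Euc d))
    (hid : SteinSD.IsInfDivWithTriplet (Pr.map X) b 0 ν)
    (hint : MeasureTheory.Integrable X Pr)
    (lam : MeasureTheory.Measure (SteinSD.UnitSphere d)) (k : SteinSD.UnitSphere d → ℝ → ℝ)
    (hpol : SteinSD.IsPolarDecomposition ν lam k)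
    (hk : SteinSD.LocallyBoundedRadial lam k)
    (h : SteinSD.Euc d → ℝ) (hh : h ∈ SteinSD.H d 2) :
    (∀ x, MeasureTheory.IntegrableOn
      (fun t => SteinSD.P (Pr.map X) t h x - ∫ y, h y ∂(Pr.map X)) (Set.Ioi 0)) ∧
    ContDiff ℝ 2 (SteinSD.steinSolution (Pr.map X) h) ∧
    SteinSD.M 1 (SteinSD.steinSolution (Pr.map X) h) ≤ ENNReal.ofReal (Real.sqrt d) ∧
    SteinSD.M 2 (SteinSD.steinSolution (Pr.map X) h) ≤ ENNReal.ofReal ((d : ℝ) / 2) := by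
  have := MeasureTheory.Measure.isProbabilityMeasure_map hX
  -- The Lévy–Khintchine formula writes `φ` as an exponential, so it has no zeros.
  have h0 : ∀ ξ, MeasureTheory.charFun (Pr.map X) ξ ≠ 0 := fun ξ => by
    rw [hid.2.2 ξ]
    exact Complex.exp_ne_zero _
  have hi : MeasureTheory.Integrable (fun y => y) (Pr.map X) :=
    (MeasureTheory.integrable_map_measure (by fun_prop) hX).2 hint
  obtain ⟨hI, hC, h1, h2⟩ := SteinSD.steinSolution_smooth hsd h0 hi hh
  have hd1 : (1 : ℝ) ≤ d := by exact_mod_cast hd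
  exact ⟨hI, hC, h1.trans (ENNReal.ofReal_le_ofReal (Real.one_le_sqrt.2 hd1)),
    h2.trans (ENNReal.ofReal_le_ofReal (by linarith))⟩
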